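/- For a field $K$ and a nonzero commutative $K$-algebra $A$, let $A/K^\times$ be the quotient hyperring: its elements are the classes $[a]=aK^\times$ ($a\in A$), with multiplication $[a][b]=[ab]$ and the multivalued addition $[a]+[b]=\{[sa+tb] : s,t\in K^\times\}$. A homomorphism of hyperrings is a map $\rho$ with $\rho(1)=1$, $\rho(xy)=\rho(x)\rho(y)$ and $\rho(x+y)\subseteq\rho(x)+\rho(y)$ for all $x,y$. A subspace of $A/K^\times$ is a subset that contains $0$, is closed under $x\mapsto -x$, and contains $x+y$ for all $x,y$ in it. The $\mathbf{K}$-dimension of a subset of $A/K^\times$ (where $\mathbf{K}$ is the Krasner hyperfield $\{0,1\}$ with $1+1=\{0,1\}$) is the least number of elements in a set generating the same subspace as that subset (it is $\infty$ if there is no finite one). Theorem. For $j=1,2$ let $K_j$ be a field with $K_j\neq\mathbb{F}_2$ and let $A_j$ be a nonzero commutative $K_j$-algebra. Let $$\rho : A_1/K_1^\times\to A_2/K_2^\times$$ be a homomorphism of hyperrings whose range has $\mathbf{K}$-dimension $>2$. Then $\rho$ is induced by a unique ring homomorphism $\tilde\rho:A_1\to A_2$, i.e. there is exactly one ring homomorphism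 $\tilde\rho$ with $\rho([a])=[\tilde\rho(a)]$ for all $a\in A_1$. Moreover $\tilde\rho$ restricts on $K_1$ to a field embedding $\alpha:K_1\to K_2$, i.e. $\tilde\rho(k\cdot 1)=\alpha(k)\cdot 1$ for all $k\in K_1$. -/

import Mathlib

/-- A canonical hypergroup: the sum `hadd x y` of two elements is a non-empty subset, with a neutral
element, unique opposites and reversibility. -/
class CanonicalHypergroup (H : Type*) extends Zero H, Neg H where
  hadd : H → H → Set H
  hadd_nonempty : ∀ x y : H, (hadd x y).Nonempty
  hadd_comm : ∀ x y : H, hadd x y = hadd y x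
  hadd_assoc : ∀ x y z : H, (⋃ a ∈ hadd x y, hadd a z) = ⋃ b ∈ hadd y z, hadd x b
  zero_hadd : ∀ x : H, hadd 0 x = {x}
  /-- The opposite of `x` is the unique `y` with `0 ∈ x + y`. -/
  zero_mem_hadd_iff : ∀ x y : H, 0 ∈ hadd x y ↔ y = -x
  reversible : ∀ x y z : H, x ∈ hadd y z → z ∈ hadd x (-y)

/-- A (Krasner) hyperring with unit, with `0 ≠ 1`. -/
class Hyperring (R : Type*) extends MonoidWithZero R, CanonicalHypergroup R, Nontrivial R where
  mul_hadd : ∀ r s t : R, (fun u => r * u) '' hadd s t = hadd (r * s) (r * t)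
  hadd_mul : ∀ r s t : R, (fun u => u * r) '' hadd s t = hadd (s * r) (t * r)

/-- A (unital) homomorphism of hyperrings. -/
structure HyperringHom (R S : Type*) [Hyperring R] [Hyperring S] extends R →* S where
  map_hadd_subset : ∀ a b : R,
    toFun '' CanonicalHypergroup.hadd a b ⊆ CanonicalHypergroup.hadd (toFun a) (toFun b)

namespace CanonicalHypergroup

variable {H : Type*} [CanonicalHypergroup H]

/-- A subhypergroup. When `x + x = {0, x}` for all `x`, that is, when `H` is a vector space over the
Krasner hyperfield, one has `-x = x` and the subhypergroups are exactly the linear subspaces. -/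
structure IsSubspace (W : Set H) : Prop where
  zero_mem : 0 ∈ W
  neg_mem : ∀ x ∈ W, -x ∈ W
  hadd_subset : ∀ x ∈ W, ∀ y ∈ W, hadd x y ⊆ W

/-- The subspace generated by a subset. -/
def hspan (S : Set H) : Set H := ⋂₀ {W | IsSubspace W ∧ S ⊆ W}

/-- The dimension of the subspace generated by `S`: the least number of elements of a set which
generates this subspace. -/
noncomputable def hdim (S : Set H) : ℕ∞ := ⨅ T ∈ {T : Set H | hspan T = hspan S}, T.encard

end CanonicalHypergroup

/-- The set `R / G` of orbits of a group `G` of units of `R` acting on `R` by multiplication. -/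
def KrasnerQuotient (R : Type*) [CommRing R] (G : Subgroup Rˣ) : Type _ :=
  MulAction.orbitRel.Quotient G R

namespace KrasnerQuotient

section

variable {R : Type*} [CommRing R] (G : Subgroup Rˣ)

/-- The class of `x` in `R / G`. -/
def mk (x : R) : KrasnerQuotient R G := Quotient.mk (MulAction.orbitRel G R) x

variable {G}

theorem mk_surjective (X : KrasnerQuotient R G) : ∃ x, mk G x = X := Quotient.exists_rep X

theorem mk_eq_mk {x y : R} : mk G x = mk G y ↔ ∃ g ∈ G, (g : R) * y = x := by
  refine (Quotient.eq (r := MulAction.orbitRel G R)).trans ?_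
  rw [MulAction.orbitRel_apply, MulAction.mem_orbit_iff]
  constructor
  · rintro ⟨g, h⟩
    exact ⟨g, g.2, h⟩
  · rintro ⟨g, hg, h⟩
    exact ⟨⟨g, hg⟩, h⟩

instance : MonoidWithZero (KrasnerQuotient R G) where
  one := mk G 1
  zero := mk G 0
  mul := Quotient.map₂ (· * ·) (by
    rintro _ a ⟨g, rfl⟩ _ b ⟨h, rfl⟩
    refine ⟨g * h, ?_⟩
    simp only [Subgroup.smul_def, Units.smul_def, Subgroup.coe_mul, Units.val_mul, smul_eq_mul]
    ring)
  mul_assoc X Y Z := by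
    obtain ⟨x, rfl⟩ := mk_surjective X
    obtain ⟨y, rfl⟩ := mk_surjective Y
    obtain ⟨z, rfl⟩ := mk_surjective Z
    exact congrArg (mk G) (mul_assoc x y z)
  one_mul X := by
    obtain ⟨x, rfl⟩ := mk_surjective X
    exact congrArg (mk G) (one_mul x)
  mul_one X := by
    obtain ⟨x, rfl⟩ := mk_surjective X
    exact congrArg (mk G) (mul_one x)
  zero_mul X := by
    obtain ⟨x, rfl⟩ := mk_surjective X
    exact congrArg (mk G) (zero_mul x)
  mul_zero X := by
    obtain ⟨x, rfl⟩ := mk_surjective X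
    exact congrArg (mk G) (mul_zero x)

theorem mk_mul (x y : R) : mk G x * mk G y = mk G (x * y) := rfl

theorem mk_zero : mk G 0 = 0 := rfl

theorem mk_one : mk G 1 = 1 := rfl

instance : Neg (KrasnerQuotient R G) where
  neg := Quotient.map (fun x => -x) (by
    rintro _ a ⟨g, rfl⟩
    exact ⟨g, by simp [Subgroup.smul_def, Units.smul_def]⟩)

theorem neg_mk (x : R) : -mk G x = mk G (-x) := rfl

/-- The hyperaddition `(xG + yG) / G`. -/
def hadd (X Y : KrasnerQuotient R G) : Set (KrasnerQuotient R G) :=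
  {Z | ∃ x y : R, mk G x = X ∧ mk G y = Y ∧ mk G (x + y) = Z}

theorem mem_hadd_mk {x y z : R} : mk G z ∈ hadd (mk G x) (mk G y) ↔
    ∃ g ∈ G, ∃ h ∈ G, (g : R) * x + (h : R) * y = z := by
  constructor
  · rintro ⟨a, b, ha, hb, hz⟩
    obtain ⟨g, hg, rfl⟩ := mk_eq_mk.1 ha
    obtain ⟨h, hh, rfl⟩ := mk_eq_mk.1 hb
    obtain ⟨k, hk, e⟩ := mk_eq_mk.1 hz
    refine ⟨k⁻¹ * g, G.mul_mem (G.inv_mem hk) hg, k⁻¹ * h, G.mul_mem (G.inv_mem hk) hh, ?_⟩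
    push_cast
    rw [mul_assoc, mul_assoc, ← mul_add, ← e, Units.inv_mul_cancel_left]
  · rintro ⟨g, hg, h, hh, rfl⟩
    exact ⟨_, _, mk_eq_mk.2 ⟨g, hg, rfl⟩, mk_eq_mk.2 ⟨h, hh, rfl⟩, rfl⟩

theorem hadd_comm' (X Y : KrasnerQuotient R G) : hadd X Y = hadd Y X := by
  ext Z
  constructor <;>
  · rintro ⟨x, y, hx, hy, hz⟩
    exact ⟨y, x, hy, hx, by rw [add_comm, hz]⟩

theorem exists_of_mem_hadd (x : R) {Y Z : KrasnerQuotient R G} (hZ : Z ∈ hadd (mk G x) Y) :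
    ∃ y, mk G y = Y ∧ mk G (x + y) = Z := by
  obtain ⟨a, y, ha, rfl, rfl⟩ := hZ
  obtain ⟨g, hg, rfl⟩ := mk_eq_mk.1 ha
  refine ⟨((g⁻¹ : Rˣ) : R) * y, mk_eq_mk.2 ⟨g⁻¹, G.inv_mem hg, rfl⟩,
    mk_eq_mk.2 ⟨g⁻¹, G.inv_mem hg, ?_⟩⟩
  rw [mul_add, Units.inv_mul_cancel_left]

theorem exists_of_mem_iUnion {X Y Z W : KrasnerQuotient R G} :
    W ∈ (⋃ a ∈ hadd X Y, hadd a Z) ↔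
      ∃ x y z, mk G x = X ∧ mk G y = Y ∧ mk G z = Z ∧ mk G (x + y + z) = W := by
  simp only [Set.mem_iUnion, exists_prop]
  constructor
  · rintro ⟨A, ⟨x, y, hx, hy, rfl⟩, hW⟩
    obtain ⟨z, hz, hw⟩ := exists_of_mem_hadd _ hW
    exact ⟨x, y, z, hx, hy, hz, hw⟩
  · rintro ⟨x, y, z, hx, hy, hz, hw⟩
    exact ⟨mk G (x + y), ⟨x, y, hx, hy, rfl⟩, ⟨_, z, rfl, hz, hw⟩⟩

instance : CanonicalHypergroup (KrasnerQuotient R G) where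
  hadd := hadd
  hadd_nonempty X Y := by
    obtain ⟨x, rfl⟩ := mk_surjective X
    obtain ⟨y, rfl⟩ := mk_surjective Y
    exact ⟨_, x, y, rfl, rfl, rfl⟩
  hadd_comm := hadd_comm'
  hadd_assoc X Y Z := by
    have e : (⋃ b ∈ hadd Y Z, hadd X b) = ⋃ b ∈ hadd Y Z, hadd b X := by
      simp only [hadd_comm' X]
    rw [e]
    ext W
    rw [exists_of_mem_iUnion, exists_of_mem_iUnion]
    constructor
    · rintro ⟨x, y, z, hx, hy, hz, hw⟩
      exact ⟨y, z, x, hy, hz, hx, by rw [← hw]; congr 1; ring⟩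
    · rintro ⟨y, z, x, hy, hz, hx, hw⟩
      exact ⟨x, y, z, hx, hy, hz, by rw [← hw]; congr 1; ring⟩
  zero_hadd X := by
    ext Z
    rw [← mk_zero, Set.mem_singleton_iff]
    constructor
    · intro h
      obtain ⟨y, hy, hz⟩ := exists_of_mem_hadd _ h
      rw [← hz, zero_add, hy]
    · rintro rfl
      obtain ⟨z, rfl⟩ := mk_surjective Z
      exact ⟨0, z, rfl, rfl, by rw [zero_add]⟩
  zero_mem_hadd_iff X Y := by
    obtain ⟨x, rfl⟩ := mk_surjective X
    constructor
    · intro h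
      obtain ⟨y, rfl, hz⟩ := exists_of_mem_hadd _ h
      obtain ⟨g, -, hg⟩ := mk_eq_mk.1 hz
      rw [mul_zero] at hg
      rw [neg_mk, neg_eq_of_add_eq_zero_right hg.symm]
    · rintro rfl
      exact ⟨x, -x, rfl, rfl, by rw [add_neg_cancel, mk_zero]⟩
  reversible X Y Z h := by
    obtain ⟨y, z, rfl, rfl, rfl⟩ := h
    exact ⟨y + z, -y, rfl, rfl, by congr 1; ring⟩

theorem mul_hadd' (X Y Z : KrasnerQuotient R G) :
    (fun U => X * U) '' hadd Y Z = hadd (X * Y) (X * Z) := by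
  obtain ⟨x, rfl⟩ := mk_surjective X
  obtain ⟨y, rfl⟩ := mk_surjective Y
  obtain ⟨z, rfl⟩ := mk_surjective Z
  ext W
  obtain ⟨w, rfl⟩ := mk_surjective W
  constructor
  · rintro ⟨U, ⟨a, b, ha, hb, rfl⟩, hw⟩
    rw [← ha, ← hb]
    exact ⟨x * a, x * b, rfl, rfl, by rw [← hw, ← mul_add]; rfl⟩
  · rw [mk_mul, mk_mul, mem_hadd_mk]
    rintro ⟨g, hg, h, hh, rfl⟩
    refine ⟨mk G (g * y + h * z), mem_hadd_mk.2 ⟨g, hg, h, hh, rfl⟩, ?_⟩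
    change mk G x * mk G _ = _
    rw [mk_mul]
    congr 1
    ring

theorem mul_comm' (X Y : KrasnerQuotient R G) : X * Y = Y * X := by
  obtain ⟨x, rfl⟩ := mk_surjective X
  obtain ⟨y, rfl⟩ := mk_surjective Y
  rw [mk_mul, mk_mul, mul_comm]

/-- The quotient hyperring `R / G`. -/
instance [Nontrivial R] : Hyperring (KrasnerQuotient R G) where
  exists_pair_ne := ⟨mk G 0, mk G 1, fun h => by
    obtain ⟨g, -, hg⟩ := mk_eq_mk.1 h
    rw [mul_one] at hg
    exact g.ne_zero hg⟩
  mul_hadd := mul_hadd'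
  hadd_mul X Y Z := by
    simp only [mul_comm' _ X]
    exact mul_hadd' X Y Z

end

end KrasnerQuotient

/-- The image of `Kˣ` in the group of units of a `K`-algebra `A`. -/
def scalarUnits (K A : Type*) [Field K] [CommRing A] [Algebra K A] : Subgroup Aˣ :=
  (Units.map (algebraMap K A : K →* A)).range

/-- The hyperring `A / Kˣ` of a commutative algebra `A` over a field `K`. -/
abbrev ScalarQuotient (K A : Type*) [Field K] [CommRing A] [Algebra K A] : Type _ :=
  KrasnerQuotient A (scalarUnits K A)

/-- The class of an element of `A` in `A / Kˣ`. -/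
abbrev ScalarQuotient.mk (K : Type*) {A : Type*} [Field K] [CommRing A] [Algebra K A] (a : A) :
    ScalarQuotient K A :=
  KrasnerQuotient.mk (scalarUnits K A) a

/-!
Lift `ρ` to a map `r : A₁ → A₂`. Compatibility with hyperaddition
says that `r (x + y) = s • r x + t • r y` with nonzero `s`, `t` in `K₂` depending on `x` and `y`.
The hypothesis on the dimension says that no two values of `r` span a space containing all of them:
otherwise the classes of these two values would generate the subspace of the range of `ρ`
(`ScalarQuotient.hdim_range_le_two`).

The core is the fundamental theorem of projective geometry for `r`, `exists_addMonoidHom_smul`: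
some rescaling `x ↦ c x • r x` is additive. For linearly independent `r x`, `r y` the ratio
`l x y = t / s` is well defined, and expanding `r (x + y + z)` in several ways shows that
`l x y * l y z = l x z` for independent triples. A vector off a given plane always exists, and coning
from it extends this identity to coplanar triangles (`IsCoeffRatio.cocycle`) and to quadrilaterals
(`IsCoeffRatio.mul_eq_mul`). Hence `l` is a coboundary, which gives the factors `c`; after rescaling,
`r (x + y)` is proportional to `r x + r y` for independent pairs, and comparison with a vector off
the plane shows equality for all pairs (`map_add_of_projective`).

Normalise the resulting additive `f` by `f 1 = 1`. For fixed `x` the additive maps `y ↦ f (x * y)` and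
`y ↦ f x * f y` are proportional at each `y`, so their ratio is constant unless the second one has
its range in a line (`exists_smul_of_forall_exists_smul`); evaluation at `y = 1` shows that the ratio
is `1`. If the range does lie in a line, replace `x` by `1 + x` (`map_mul_of_projective`). Uniqueness
also follows from the constancy of ratios. Finally `f` sends `K₁` into `K₂` since each nonzero scalar
has the class of `1`.
-/

/-! ### Linearly independent pairs and triples -/

section LinearIndependence

variable {K W : Type*} [Field K] [AddCommGroup W] [Module K W]

theorem linearIndependent_triple_iff {x y z : W} : LinearIndependent K ![x, y, z] ↔
    ∀ a b c : K, a • x + b • y + c • z = 0 → a = 0 ∧ b = 0 ∧ c = 0 := by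
  rw [Fintype.linearIndependent_iff]
  constructor
  · intro h a b c e
    have := h ![a, b, c] (by simpa [Fin.sum_univ_three] using e)
    exact ⟨this 0, this 1, this 2⟩
  · intro h g e
    obtain ⟨h0, h1, h2⟩ := h (g 0) (g 1) (g 2) (by simpa [Fin.sum_univ_three] using e)
    intro i
    fin_cases i <;> assumption

theorem LinearIndependent.triple_of_notMem_span {x y z : W} (h : LinearIndependent K ![x, y])
    (hz : z ∉ Submodule.span K {x, y}) : LinearIndependent K ![x, y, z] := by
  rw [linearIndependent_triple_iff]
  rw [LinearIndependent.pair_iff] at h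
  rw [Submodule.mem_span_pair] at hz
  intro a b c e
  have hc : c = 0 := by
    by_contra hc
    refine hz ⟨-(c⁻¹ * a), -(c⁻¹ * b), ?_⟩
    rw [← sub_eq_zero, ← neg_eq_zero, ← smul_eq_zero_iff_right hc, ← e]
    match_scalars <;> field_simp
  subst hc
  obtain ⟨ha, hb⟩ := h a b (by simpa using e)
  exact ⟨ha, hb, rfl⟩

theorem LinearIndependent.triple_rotate {x y z : W} (h : LinearIndependent K ![x, y, z]) :
    LinearIndependent K ![y, z, x] := by
  rw [linearIndependent_triple_iff] at h ⊢
  intro b c a e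
  obtain ⟨ha, hb, hc⟩ := h a b c (by rw [← e]; abel)
  exact ⟨hb, hc, ha⟩

theorem LinearIndependent.triple_fst_snd {x y z : W} (h : LinearIndependent K ![x, y, z]) :
    LinearIndependent K ![x, y] := by
  rw [linearIndependent_triple_iff] at h
  rw [LinearIndependent.pair_iff]
  intro a b e
  obtain ⟨ha, hb, -⟩ := h a b 0 (by simpa using e)
  exact ⟨ha, hb⟩

theorem LinearIndependent.pair_swap {x y : W} (h : LinearIndependent K ![x, y]) :
    LinearIndependent K ![y, x] :=
  LinearIndependent.pair_symm_iff.1 h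

theorem LinearIndependent.pair_fst_ne_zero {x y : W} (h : LinearIndependent K ![x, y]) :
    x ≠ 0 := h.ne_zero 0

theorem LinearIndependent.pair_snd_ne_zero {x y : W} (h : LinearIndependent K ![x, y]) :
    y ≠ 0 := h.ne_zero 1

theorem linearIndependent_pair_of_notMem_span {x y z : W} (hx : x ≠ 0)
    (hz : z ∉ Submodule.span K {x, y}) : LinearIndependent K ![x, z] := by
  rw [LinearIndependent.pair_iff' hx]
  rintro a rfl
  exact hz (Submodule.smul_mem _ _ (Submodule.subset_span (by simp)))

theorem LinearIndependent.pair_coeff_eq {x y : W} (h : LinearIndependent K ![x, y])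
    {a b a' b' : K} (e : a • x + b • y = a' • x + b' • y) : a = a' ∧ b = b' := by
  rw [LinearIndependent.pair_iff] at h
  obtain ⟨ha, hb⟩ := h (a - a') (b - b') (by rw [← sub_eq_zero.2 e]; module)
  exact ⟨sub_eq_zero.1 ha, sub_eq_zero.1 hb⟩

theorem LinearIndependent.triple_coeff_eq {x y z : W} (h : LinearIndependent K ![x, y, z])
    {a b c a' b' c' : K} (e : a • x + b • y + c • z = a' • x + b' • y + c' • z) :
    a = a' ∧ b = b' ∧ c = c' := by
  rw [linearIndependent_triple_iff] at h
  obtain ⟨ha, hb, hc⟩ := h (a - a') (b - b') (c - c') (by rw [← sub_eq_zero.2 e]; module)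
  exact ⟨sub_eq_zero.1 ha, sub_eq_zero.1 hb, sub_eq_zero.1 hc⟩

end LinearIndependence

/-! ### Lifting a morphism of projective geometries to an additive map -/

section Projective

variable {K V W : Type*} [Field K] [AddCommGroup V] [AddCommGroup W] [Module K W]

/-- No plane of `W` spanned by two values of `r` contains the range of `r`. -/
def NotInPlane (K : Type*) {V W : Type*} [Field K] [AddCommGroup W] [Module K W]
    (r : V → W) : Prop :=
  ∀ x y : V, ∃ z : V, r z ∉ Submodule.span K {r x, r y}

/-- `l x y` is a ratio of the coefficients of `r y` and `r x` in `r (x + y)`; it is determined by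
`r` when `r x` and `r y` are linearly independent. -/
def IsCoeffRatio (r : V → W) (l : V → V → K) : Prop :=
  ∀ x y : V, l x y ≠ 0 ∧ ∃ c : K, c ≠ 0 ∧ r (x + y) = c • (r x + l x y • r y)

variable {r : V → W} {l : V → V → K}

/-- The three products are read off the expansion of `r (x + y + z)`. -/
theorem IsCoeffRatio.cocycle_of_triple (hl : IsCoeffRatio r l) {x y z : V}
    (h : LinearIndependent K ![r x, r y, r z]) : l x y * l y z = l x z := by
  obtain ⟨-, c₁, hc₁, e₁⟩ := hl x y
  obtain ⟨-, c₂, hc₂, e₂⟩ := hl y z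
  obtain ⟨-, c₃, hc₃, e₃⟩ := hl x z
  obtain ⟨-, d₁, hd₁, f₁⟩ := hl (x + y) z
  obtain ⟨-, d₂, hd₂, f₂⟩ := hl x (y + z)
  obtain ⟨-, d₃, hd₃, f₃⟩ := hl (x + z) y
  rw [e₁] at f₁
  rw [← add_assoc, e₂] at f₂
  rw [add_right_comm, e₃] at f₃
  obtain ⟨p1, p2, p3⟩ := h.triple_coeff_eq (a := d₁ * c₁) (b := d₁ * c₁ * l x y)
    (c := d₁ * l (x + y) z) (a' := d₂) (b' := d₂ * l x (y + z) * c₂)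
    (c' := d₂ * l x (y + z) * c₂ * l y z) (by linear_combination (norm := module) f₂ - f₁)
  obtain ⟨q1, q2, q3⟩ := h.triple_coeff_eq (a := d₁ * c₁) (b := d₁ * c₁ * l x y)
    (c := d₁ * l (x + y) z) (a' := d₃ * c₃) (b' := d₃ * l (x + z) y)
    (c' := d₃ * c₃ * l x z) (by linear_combination (norm := module) f₃ - f₁)
  refine mul_left_cancel₀ (mul_ne_zero hd₁ hc₁) ?_
  linear_combination l y z * p2 - p3 + q3 - l x z * q1

/-- If the three vectors are coplanar, this is a cone over a triangle, with a vertex off the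
plane. -/
theorem IsCoeffRatio.cocycle (hl : IsCoeffRatio r l) (hr : NotInPlane K r) {x y z : V}
    (hxy : LinearIndependent K ![r x, r y]) (hyz : LinearIndependent K ![r y, r z])
    (hxz : LinearIndependent K ![r x, r z]) : l x y * l y z = l x z := by
  by_cases hz : r z ∈ Submodule.span K {r x, r y}
  · obtain ⟨w, hw⟩ := hr x y
    have h1 : Submodule.span K {r x, r z} ≤ Submodule.span K {r x, r y} := by
      rw [Submodule.span_le, Set.insert_subset_iff, Set.singleton_subset_iff]
      exact ⟨Submodule.subset_span (by simp), hz⟩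
    have h2 : Submodule.span K {r y, r z} ≤ Submodule.span K {r x, r y} := by
      rw [Submodule.span_le, Set.insert_subset_iff, Set.singleton_subset_iff]
      exact ⟨Submodule.subset_span (by simp), hz⟩
    have txy := hxy.triple_of_notMem_span hw
    have tyz := hyz.triple_of_notMem_span fun h => hw (h2 h)
    have txz := hxz.triple_of_notMem_span fun h => hw (h1 h)
    have e1 := hl.cocycle_of_triple txy
    have e2 := hl.cocycle_of_triple tyz
    have e3 := hl.cocycle_of_triple txz
    refine mul_right_cancel₀ (hl z w).1 ?_
    rw [mul_assoc, e2, e1, e3]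
  · exact hl.cocycle_of_triple (hxy.triple_of_notMem_span hz)

/-- The product along a path of length two from `x` to `y` only depends on `x` and `y`, which may
have proportional images. -/
theorem IsCoeffRatio.mul_eq_mul (hl : IsCoeffRatio r l) (hr : NotInPlane K r) {x y z z' : V}
    (hxz : LinearIndependent K ![r x, r z]) (hzy : LinearIndependent K ![r z, r y])
    (hxz' : LinearIndependent K ![r x, r z']) (hzy' : LinearIndependent K ![r z', r y]) :
    l x z * l z y = l x z' * l z' y := by
  by_cases hxy : LinearIndependent K ![r x, r y]
  · rw [hl.cocycle hr hxz hzy hxy, hl.cocycle hr hxz' hzy' hxy]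
  by_cases hzz : LinearIndependent K ![r z, r z']
  · rw [← hl.cocycle hr hxz hzz hxz', mul_assoc, hl.cocycle hr hzz hzy' hzy]
  rw [LinearIndependent.pair_iff' hxz.pair_fst_ne_zero] at hxy
  rw [LinearIndependent.pair_iff' hxz.pair_snd_ne_zero] at hzz
  push Not at hxy hzz
  obtain ⟨a, ha⟩ := hxy
  obtain ⟨b, hb⟩ := hzz
  obtain ⟨w, hw⟩ := hr x z
  have hx : r x ∈ Submodule.span K {r x, r z} := Submodule.subset_span (by simp)
  have hz : r z ∈ Submodule.span K {r x, r z} := Submodule.subset_span (by simp)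
  have key : ∀ u, r u ≠ 0 → r u ∈ Submodule.span K {r x, r z} →
      LinearIndependent K ![r u, r w] := fun u h0 hu => by
    rw [LinearIndependent.pair_iff' h0]
    rintro c h
    exact hw (h ▸ Submodule.smul_mem _ _ hu)
  have hxw := key x hxz.pair_fst_ne_zero hx
  have hzw := key z hxz.pair_snd_ne_zero hz
  have hyw := key y hzy.pair_snd_ne_zero (ha ▸ Submodule.smul_mem _ _ hx)
  have hzw' := key z' hxz'.pair_snd_ne_zero (hb ▸ Submodule.smul_mem _ _ hz)
  rw [← hl.cocycle hr hxw hzw.pair_swap hxz, ← hl.cocycle hr hxw hzw'.pair_swap hxz',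
    mul_assoc, mul_assoc, hl.cocycle hr hzw.pair_swap hzy hyw.pair_swap,
    hl.cocycle hr hzw'.pair_swap hzy' hyw.pair_swap]

/-- The cocycle `l` is a coboundary. -/
theorem IsCoeffRatio.exists_coboundary (hl : IsCoeffRatio r l) (hr : NotInPlane K r) :
    ∃ c : V → K, (∀ x, c x ≠ 0) ∧
      ∀ x y, LinearIndependent K ![r x, r y] → c y = c x * l x y := by
  obtain ⟨e, he⟩ := hr 0 0
  have he : r e ≠ 0 := fun h => he (h ▸ Submodule.zero_mem _)
  -- A common neighbour of `e` and `x`; the choice is immaterial if `r x = 0`.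
  have hw : ∀ x, ∃ w, LinearIndependent K ![r e, r w] ∧
      (r x ≠ 0 → LinearIndependent K ![r w, r x]) := fun x => by
    obtain ⟨w, hw⟩ := hr e x
    refine ⟨w, linearIndependent_pair_of_notMem_span he hw, fun hx => ?_⟩
    rw [Set.pair_comm] at hw
    exact (linearIndependent_pair_of_notMem_span hx hw).pair_swap
  choose w hew hwx using hw
  refine ⟨fun x => l e (w x) * l (w x) x, fun x => mul_ne_zero (hl _ _).1 (hl _ _).1, ?_⟩
  intro x y hxy
  have hx := hxy.pair_fst_ne_zero
  have hy := hxy.pair_snd_ne_zero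
  obtain ⟨u, hue, hux, huy⟩ : ∃ u, LinearIndependent K ![r e, r u] ∧
      LinearIndependent K ![r u, r x] ∧ LinearIndependent K ![r u, r y] := by
    by_cases hexy : r e ∈ Submodule.span K {r x, r y}
    · obtain ⟨u, hu⟩ := hr x y
      refine ⟨u, ?_, (linearIndependent_pair_of_notMem_span hx hu).pair_swap, ?_⟩
      · rw [LinearIndependent.pair_iff' he]
        rintro a h
        exact hu (h ▸ Submodule.smul_mem _ _ hexy)
      · rw [Set.pair_comm] at hu
        exact (linearIndependent_pair_of_notMem_span hy hu).pair_swap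
    · -- In general position, `x + y` is on none of the three lines.
      obtain ⟨hlxy, c, hc, hu⟩ := hl x y
      rw [LinearIndependent.pair_iff] at hxy
      have hu' : r (x + y) ≠ 0 := fun h => hc (hxy c (c * l x y) (by
        rw [← h, hu]; module)).1
      refine ⟨x + y, ?_, ?_, ?_⟩
      · refine LinearIndependent.pair_swap ?_
        rw [LinearIndependent.pair_iff' hu']
        rintro a h
        refine hexy ?_
        rw [← h, hu]
        exact Submodule.smul_mem _ _ (Submodule.smul_mem _ _ (Submodule.add_mem _
          (Submodule.subset_span (by simp))
          (Submodule.smul_mem _ _ (Submodule.subset_span (by simp)))))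
      · refine LinearIndependent.pair_swap ?_
        rw [LinearIndependent.pair_iff' hx]
        rintro a h
        rw [hu] at h
        exact mul_ne_zero hc hlxy
          (hxy (c - a) (c * l x y) (by rw [← sub_eq_zero.2 h.symm]; module)).2
      · refine LinearIndependent.pair_swap ?_
        rw [LinearIndependent.pair_iff' hy]
        rintro a h
        rw [hu] at h
        exact hc (hxy c (c * l x y - a) (by rw [← sub_eq_zero.2 h.symm]; module)).1
  simp only
  rw [hl.mul_eq_mul hr (hew x) (hwx x hx) hue hux, hl.mul_eq_mul hr (hew y) (hwx y hy) hue huy,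
    mul_assoc, hl.cocycle hr hux hxy huy]

/-- A map which is additive up to scalars on pairs with independent images, and whose range spans
more than a plane, is additive. -/
theorem map_add_of_projective {f : V → W} (hf : NotInPlane K f)
    (hst : ∀ x y, ∃ s t : K, s ≠ 0 ∧ t ≠ 0 ∧ f (x + y) = s • f x + t • f y)
    (hadd : ∀ x y, LinearIndependent K ![f x, f y] → ∃ c : K, f (x + y) = c • (f x + f y))
    (x y : V) : f (x + y) = f x + f y := by
  have indep : ∀ x y, LinearIndependent K ![f x, f y] → f (x + y) = f x + f y := by
    intro x y hxy
    obtain ⟨z, hz⟩ := hf x y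
    have h3 := hxy.triple_of_notMem_span hz
    obtain ⟨c, hc⟩ := hadd x y hxy
    obtain ⟨d, hd⟩ := hadd y z h3.triple_rotate.triple_fst_snd
    obtain ⟨s, t, hs, ht, e⟩ := hst (x + y) z
    obtain ⟨s', t', hs', ht', e'⟩ := hst x (y + z)
    have hc0 : c ≠ 0 := by
      rintro rfl
      obtain ⟨s, t, hs, ht, e⟩ := hst x y
      rw [hc] at e
      exact hs (hxy.pair_coeff_eq (a := 0) (b := 0) (a' := s) (b' := t) (by
        rw [← e]; module)).1.symm
    have hlin : LinearIndependent K ![f (x + y), f z] := by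
      rw [linearIndependent_triple_iff] at h3
      rw [LinearIndependent.pair_iff]
      intro a b e
      obtain ⟨h1, -, h2⟩ := h3 (a * c) (a * c) b (by rw [← e, hc]; module)
      exact ⟨(mul_eq_zero.1 h1).resolve_right hc0, h2⟩
    have hd0 : d ≠ 0 := by
      rintro rfl
      obtain ⟨s, t, hs, ht, e⟩ := hst y z
      rw [hd] at e
      exact hs (h3.triple_rotate.triple_fst_snd.pair_coeff_eq (a := 0) (b := 0) (a' := s)
        (b' := t) (by rw [← e]; module)).1.symm
    have hlin' : LinearIndependent K ![f x, f (y + z)] := by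
      rw [linearIndependent_triple_iff] at h3
      rw [LinearIndependent.pair_iff]
      intro a b e
      obtain ⟨h1, -, h2⟩ := h3 a (b * d) (b * d) (by rw [← e, hd]; module)
      exact ⟨h1, (mul_eq_zero.1 h2).resolve_right hd0⟩
    obtain ⟨p, hp⟩ := hadd _ _ hlin
    obtain ⟨q, hq⟩ := hadd _ _ hlin'
    have hp0 : p ≠ 0 := by
      rintro rfl
      rw [hp] at e
      exact hs (hlin.pair_coeff_eq (a := 0) (b := 0) (a' := s) (b' := t) (by
        rw [← e]; module)).1.symm
    rw [← add_assoc, hp, hc, hd] at hq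
    obtain ⟨h1, h2, h3⟩ := h3.triple_coeff_eq (a := p * c) (b := p * c) (c := p) (a' := q)
      (b' := q * d) (c' := q * d) (by linear_combination (norm := module) hq)
    have : c = 1 := mul_left_cancel₀ hp0 (by rw [h2, mul_one, h3])
    rw [hc, this, one_smul]
  have zero : ∀ x z, f x = 0 → f (x + z) = f z := by
    intro x z hx
    obtain ⟨s, t, hs, ht, e⟩ := hst x z
    rw [hx, smul_zero, zero_add] at e
    by_cases hz : f z = 0
    · rw [e, hz, smul_zero]
    obtain ⟨y, hy⟩ := hf z z
    have hzy := linearIndependent_pair_of_notMem_span hz hy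
    obtain ⟨s', t', hs', ht', e'⟩ := hst x y
    rw [hx, smul_zero, zero_add] at e'
    have h1 : LinearIndependent K ![f (x + z), f y] := by
      rw [LinearIndependent.pair_iff] at hzy ⊢
      intro a b h
      rw [e, smul_smul] at h
      obtain ⟨h1, h2⟩ := hzy _ _ h
      exact ⟨(mul_eq_zero.1 h1).resolve_right ht, h2⟩
    have h2 : LinearIndependent K ![f z, f (x + y)] := by
      rw [LinearIndependent.pair_iff] at hzy ⊢
      intro a b h
      rw [e', smul_smul] at h
      obtain ⟨h1, h2⟩ := hzy _ _ h
      exact ⟨h1, (mul_eq_zero.1 h2).resolve_right ht'⟩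
    have e1 := indep _ _ h1
    have e2 := indep _ _ h2
    rw [show z + (x + y) = x + z + y by abel, e1, e, e'] at e2
    have := (hzy.pair_coeff_eq (a := t) (b := 1) (a' := 1) (b' := t') (by
      simpa using e2)).1
    rw [e, this, one_smul]
  by_cases hx : f x = 0
  · rw [zero x y hx, hx, zero_add]
  by_cases hy : f y = 0
  · rw [add_comm, zero y x hy, hy, add_zero]
  by_cases hxy : LinearIndependent K ![f x, f y]
  · exact indep x y hxy
  rw [LinearIndependent.pair_iff' hx] at hxy
  push Not at hxy
  obtain ⟨a, ha⟩ := hxy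
  obtain ⟨z, hz⟩ := hf x y
  have hxz := linearIndependent_pair_of_notMem_span hx hz
  have hyz := linearIndependent_pair_of_notMem_span hy (Set.pair_comm (f x) (f y) ▸ hz)
  have e1 : f (x + (y + z)) = f x + (f y + f z) := by
    have hyz' := indep y z hyz
    rw [← hyz']
    refine indep _ _ ?_
    rw [LinearIndependent.pair_iff] at hxz ⊢
    intro b c h
    obtain ⟨h1, h2⟩ := hxz (b + c * a) c (by rw [← h, hyz', ← ha]; module)
    subst h2
    exact ⟨by simpa using h1, rfl⟩
  have e2 : f (x + y + z) = f (x + y) + f z := by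
    by_cases h0 : f (x + y) = 0
    · rw [zero _ _ h0, h0, zero_add]
    refine indep _ _ ?_
    obtain ⟨s, t, -, -, e⟩ := hst x y
    rw [LinearIndependent.pair_iff' h0]
    rintro b h
    refine hz ?_
    rw [← h, e]
    exact Submodule.smul_mem _ _ (Submodule.mem_span_pair.2 ⟨s, t, rfl⟩)
  rw [add_assoc, e1, ← add_assoc] at e2
  exact (add_right_cancel e2).symm

/-- A form of the fundamental theorem of projective geometry. The maps need not be injective on
lines, and `V` is only an abelian group. -/
theorem exists_addMonoidHom_smul (hr : NotInPlane K r)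
    (hst : ∀ x y, ∃ s t : K, s ≠ 0 ∧ t ≠ 0 ∧ r (x + y) = s • r x + t • r y) :
    ∃ f : V →+ W, ∀ x, ∃ c : K, c ≠ 0 ∧ f x = c • r x := by
  choose s t hs ht e using hst
  have hl : IsCoeffRatio r fun x y => (s x y)⁻¹ * t x y := fun x y => by
    refine ⟨mul_ne_zero (inv_ne_zero (hs x y)) (ht x y), s x y, hs x y, ?_⟩
    rw [smul_add, smul_smul, mul_inv_cancel_left₀ (hs x y), e]
  obtain ⟨c, hc, hcl⟩ := hl.exists_coboundary hr
  have key : ∀ x y, c (x + y) • r (x + y) = c x • r x + c y • r y := by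
    refine map_add_of_projective (K := K) (f := fun x => c x • r x) ?_ ?_ ?_
    · intro x y
      obtain ⟨z, hz⟩ := hr x y
      refine ⟨z, fun h => hz ?_⟩
      obtain ⟨a, b, h⟩ := Submodule.mem_span_pair.1 h
      refine Submodule.mem_span_pair.2 ⟨(c z)⁻¹ * (a * c x), (c z)⁻¹ * (b * c y), ?_⟩
      rw [← inv_smul_smul₀ (hc z) (r z)]
      simp only at h
      rw [← h]
      module
    · intro x y
      refine ⟨c (x + y) * s x y * (c x)⁻¹, c (x + y) * t x y * (c y)⁻¹, ?_, ?_, ?_⟩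
      · exact mul_ne_zero (mul_ne_zero (hc _) (hs _ _)) (inv_ne_zero (hc _))
      · exact mul_ne_zero (mul_ne_zero (hc _) (ht _ _)) (inv_ne_zero (hc _))
      · have := hc x
        have := hc y
        rw [e]
        match_scalars <;> field_simp
    · intro x y hxy
      have hxy' : LinearIndependent K ![r x, r y] := by
        rw [LinearIndependent.pair_iff] at hxy ⊢
        intro a b h
        obtain ⟨h1, h2⟩ := hxy (a * (c x)⁻¹) (b * (c y)⁻¹) (by
          simp only [mul_smul, inv_smul_smul₀ (hc _), h])
        exact ⟨(mul_eq_zero.1 h1).resolve_right (inv_ne_zero (hc x)),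
          (mul_eq_zero.1 h2).resolve_right (inv_ne_zero (hc y))⟩
      refine ⟨c (x + y) * s x y * (c x)⁻¹, ?_⟩
      have := hc x
      have := hs x y
      rw [hcl x y hxy', e]
      match_scalars <;> field_simp
  exact ⟨AddMonoidHom.mk' (fun x => c x • r x) key, fun x => ⟨c x, hc x, rfl⟩⟩

/-- Proportional additive maps have a constant ratio, unless their ranges lie in a line. -/
theorem exists_smul_of_forall_exists_smul {g h : V →+ W} (hgh : ∀ x, ∃ c : K, g x = c • h x)
    {a b : V} (hab : LinearIndependent K ![h a, h b]) : ∃ c : K, ∀ x, g x = c • h x := by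
  have key : ∀ x y (c : K), LinearIndependent K ![h x, h y] → g x = c • h x → g y = c • h y := by
    intro x y c hxy hx
    obtain ⟨d, hd⟩ := hgh y
    obtain ⟨p, hp⟩ := hgh (x + y)
    rw [map_add, map_add, hx, hd, smul_add] at hp
    obtain ⟨h1, h2⟩ := hxy.pair_coeff_eq hp
    rw [hd, h1, h2]
  obtain ⟨c, hc⟩ := hgh a
  refine ⟨c, fun x => ?_⟩
  by_cases hx : h x = 0
  · obtain ⟨d, hd⟩ := hgh x
    rw [hd, hx, smul_zero, smul_zero]
  by_cases hax : LinearIndependent K ![h a, h x]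
  · exact key a x c hax hc
  refine key b x c ?_ (key a b c hab hc)
  rw [LinearIndependent.pair_iff' hab.pair_fst_ne_zero] at hax
  push Not at hax
  obtain ⟨d, hd⟩ := hax
  rw [LinearIndependent.pair_iff] at hab ⊢
  intro p q e
  obtain ⟨h1, rfl⟩ := hab (q * d) p (by rw [← e, ← hd]; module)
  refine ⟨rfl, (mul_eq_zero.1 h1).resolve_right ?_⟩
  rintro rfl
  exact hx (by rw [← hd, zero_smul])

end Projective

/-! ### From additive to multiplicative maps -/

section Multiplicative

variable {K A B : Type*} [Field K] [CommRing A] [CommRing B] [Algebra K B]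

/-- The element `x` is treated directly if `f x * f y`, for varying `y`, does not stay in a line.
Otherwise this line is spanned by `f x`, and `1 + x` can be treated directly. -/
theorem map_mul_of_projective {f : A →+ B} (hf : NotInPlane K f) (h1 : f 1 = 1)
    (hmul : ∀ x y, ∃ c : K, f (x * y) = c • (f x * f y)) (x y : A) :
    f (x * y) = f x * f y := by
  have good : ∀ x a b, LinearIndependent K ![f x * f a, f x * f b] →
      ∀ y, f (x * y) = f x * f y := by
    intro x a b hab
    obtain ⟨c, hc⟩ := exists_smul_of_forall_exists_smul (g := f.comp (AddMonoidHom.mulLeft x))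
      (h := (AddMonoidHom.mulLeft (f x)).comp f) (hmul x) hab
    simp only [AddMonoidHom.comp_apply, AddMonoidHom.coe_mulLeft] at hc
    have hx : f x ≠ 0 := fun h => hab.pair_fst_ne_zero (by rw [h, zero_mul])
    have hc1 : c = 1 := by
      have e := hc 1
      rw [mul_one, h1, mul_one] at e
      exact smul_left_injective K hx (by simpa using e.symm)
    intro y
    rw [hc, hc1, one_smul]
  by_cases hx : f x = 0
  · obtain ⟨c, hc⟩ := hmul x y
    rw [hc, hx, zero_mul, smul_zero]
  by_cases hline : ∃ a, LinearIndependent K ![f x * f 1, f x * f a]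
  · obtain ⟨a, ha⟩ := hline
    exact good x 1 a ha y
  push Not at hline
  have hl : ∀ a, ∃ c : K, c • f x = f x * f a := fun a => by
    have := hline a
    rw [h1, mul_one, LinearIndependent.pair_iff' hx] at this
    push Not at this
    exact this
  obtain ⟨a, ha⟩ := hf x x
  have hxa := linearIndependent_pair_of_notMem_span hx ha
  obtain ⟨b, hb⟩ := hf x a
  have h3 := hxa.triple_of_notMem_span hb
  obtain ⟨c, hc⟩ := hl a
  obtain ⟨d, hd⟩ := hl b
  have e := good (1 + x) a b (by
    rw [linearIndependent_triple_iff] at h3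
    rw [LinearIndependent.pair_iff, map_add, h1, add_mul, add_mul, ← hc, ← hd, one_mul, one_mul]
    intro p q e
    exact (h3 (p * c + q * d) p q (by rw [← e]; module)).2) y
  rw [add_mul, map_add, map_add, h1, add_mul, one_mul, one_mul] at e
  exact add_left_cancel e

end Multiplicative

/-! ### Scalar quotients and their subspaces -/

namespace ScalarQuotient

open CanonicalHypergroup

variable {K A : Type*} [Field K] [CommRing A] [Algebra K A]

theorem mk_eq_mk_iff {x y : A} : mk K x = mk K y ↔ ∃ c : K, c ≠ 0 ∧ x = c • y := by
  refine KrasnerQuotient.mk_eq_mk.trans ⟨?_, ?_⟩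
  · rintro ⟨_, ⟨c, rfl⟩, rfl⟩
    exact ⟨c, c.ne_zero, by simp [Algebra.smul_def]⟩
  · rintro ⟨c, hc, rfl⟩
    exact ⟨_, ⟨Units.mk0 c hc, rfl⟩, by simp [Algebra.smul_def]⟩

theorem mk_add_mem_hadd (x y : A) : mk K (x + y) ∈ hadd (mk K x) (mk K y) :=
  ⟨x, y, rfl, rfl, rfl⟩

theorem exists_smul_add_smul_of_mem_hadd {x y z : A} (h : mk K z ∈ hadd (mk K x) (mk K y)) :
    ∃ s t : K, s ≠ 0 ∧ t ≠ 0 ∧ z = s • x + t • y := by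
  obtain ⟨_, ⟨s, rfl⟩, _, ⟨t, rfl⟩, h⟩ := KrasnerQuotient.mem_hadd_mk.1 h
  exact ⟨s, t, s.ne_zero, t.ne_zero, by simp [← h, Algebra.smul_def]⟩

theorem mk_smul_mem {W : Set (ScalarQuotient K A)} (hW : IsSubspace W) (c : K) {x : A}
    (hx : mk K x ∈ W) : mk K (c • x) ∈ W := by
  by_cases hc : c = 0
  · rw [hc, zero_smul]
    exact hW.zero_mem
  · rwa [mk_eq_mk_iff.2 ⟨c, hc, rfl⟩]

theorem mk_mem_of_mem_span_pair {W : Set (ScalarQuotient K A)} (hW : IsSubspace W) {x y z : A}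
    (hx : mk K x ∈ W) (hy : mk K y ∈ W) (hz : z ∈ Submodule.span K {x, y}) : mk K z ∈ W := by
  obtain ⟨a, b, rfl⟩ := Submodule.mem_span_pair.1 hz
  exact hW.hadd_subset _ (mk_smul_mem hW a hx) _ (mk_smul_mem hW b hy) (mk_add_mem_hadd _ _)

/-- Subspaces of `A / Kˣ` are the images of linear subspaces of `A`, so the classes of two spanning
vectors generate the subspace of their plane. -/
theorem hdim_range_le_two {V : Type*} {r : V → A} {x y : V}
    (h : ∀ z, r z ∈ Submodule.span K {r x, r y}) :
    hdim (Set.range fun z => mk K (r z)) ≤ 2 := by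
  refine (iInf₂_le {mk K (r x), mk K (r y)} ?_).trans ?_
  swap
  · refine (Set.encard_insert_le _ _).trans ?_
    rw [Set.encard_singleton, one_add_one_eq_two]
  apply Set.Subset.antisymm
  · refine Set.sInter_subset_sInter fun W hW => ⟨hW.1, ?_⟩
    rintro _ (rfl | rfl)
    · exact hW.2 ⟨x, rfl⟩
    · exact hW.2 ⟨y, rfl⟩
  · refine Set.sInter_subset_sInter fun W hW => ⟨hW.1, ?_⟩
    rintro _ ⟨z, rfl⟩
    exact mk_mem_of_mem_span_pair hW.1 (hW.2 (by simp)) (hW.2 (by simp)) (h z)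

end ScalarQuotient

open ScalarQuotient in
theorem theorem3p11 {K₁ K₂ A₁ A₂ : Type*} [Field K₁] [Field K₂] [CommRing A₁] [CommRing A₂]
    [Algebra K₁ A₁] [Algebra K₂ A₂] [Nontrivial A₁] [Nontrivial A₂]
    (hK₁ : Nat.card K₁ ≠ 2) (hK₂ : Nat.card K₂ ≠ 2)
    (ρ : HyperringHom (ScalarQuotient K₁ A₁) (ScalarQuotient K₂ A₂))
    (hρ : 2 < CanonicalHypergroup.hdim (Set.range ρ.toMonoidHom)) :
    ∃ f : A₁ →+* A₂,
      (∀ x : A₁, ρ.toMonoidHom (ScalarQuotient.mk K₁ x) = ScalarQuotient.mk K₂ (f x)) ∧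
      (∃ α : K₁ →+* K₂, ∀ k : K₁, f (algebraMap K₁ A₁ k) = algebraMap K₂ A₂ (α k)) ∧
      ∀ g : A₁ →+* A₂,
        (∀ x : A₁, ρ.toMonoidHom (ScalarQuotient.mk K₁ x) = ScalarQuotient.mk K₂ (g x)) → g = f := by
  have notInPlane : ∀ r : A₁ → A₂, (∀ x, ρ.toMonoidHom (mk K₁ x) = mk K₂ (r x)) →
      NotInPlane K₂ r := by
    intro r hr x y
    by_contra! h
    refine hρ.not_ge (le_of_eq_of_le ?_ (hdim_range_le_two h))
    congr 1
    ext Z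
    constructor
    · rintro ⟨X, rfl⟩
      obtain ⟨x, rfl⟩ := KrasnerQuotient.mk_surjective X
      exact ⟨x, (hr x).symm⟩
    · rintro ⟨x, rfl⟩
      exact ⟨mk K₁ x, hr x⟩
  have lift : ∀ x, ∃ w, ρ.toMonoidHom (mk K₁ x) = mk K₂ w := fun x =>
    (KrasnerQuotient.mk_surjective (ρ.toMonoidHom (mk K₁ x))).imp fun _ h => h.symm
  choose r hr using lift
  obtain ⟨f₀, hf₀⟩ := exists_addMonoidHom_smul (notInPlane r hr) fun x y => by
    apply exists_smul_add_smul_of_mem_hadd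
    rw [← hr, ← hr, ← hr]
    exact ρ.map_hadd_subset _ _ ⟨_, mk_add_mem_hadd x y, rfl⟩
  have hf₀ρ : ∀ x, ρ.toMonoidHom (mk K₁ x) = mk K₂ (f₀ x) := fun x => by
    rw [hr, mk_eq_mk_iff.2 (hf₀ x)]
  have hone : ρ.toMonoidHom (mk K₁ 1) = mk K₂ 1 := map_one ρ.toMonoidHom
  obtain ⟨u, hu, hu1⟩ := mk_eq_mk_iff.1 ((hf₀ρ 1).symm.trans hone)
  -- Rescale so that `1` is sent to `1`.
  obtain ⟨f, hfρ, hf1⟩ : ∃ f : A₁ →+ A₂, (∀ x, ρ.toMonoidHom (mk K₁ x) = mk K₂ (f x)) ∧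
      f 1 = 1 := by
    refine ⟨(DistribSMul.toAddMonoidHom A₂ u⁻¹).comp f₀, fun x => ?_, ?_⟩
    · rw [hf₀ρ]
      exact (mk_eq_mk_iff.2 ⟨u⁻¹, inv_ne_zero hu, rfl⟩).symm
    · change u⁻¹ • f₀ 1 = 1
      rw [hu1, inv_smul_smul₀ hu]
  have hf := notInPlane f hfρ
  have hfmul : ∀ x y, f (x * y) = f x * f y := by
    refine map_mul_of_projective hf hf1 fun x y => ?_
    have : mk K₂ (f (x * y)) = mk K₂ (f x * f y) := by
      rw [← hfρ]
      refine (map_mul ρ.toMonoidHom (mk K₁ x) (mk K₁ y)).trans ?_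
      rw [hfρ, hfρ]
      rfl
    obtain ⟨c, -, hc⟩ := mk_eq_mk_iff.1 this
    exact ⟨c, hc⟩
  let F : A₁ →+* A₂ := { f with map_one' := hf1, map_mul' := hfmul, map_zero' := map_zero f }
  refine ⟨F, hfρ, ?_, ?_⟩
  · have hα : ∀ k, ∃ a, F (algebraMap K₁ A₁ k) = algebraMap K₂ A₂ a := by
      intro k
      by_cases hk : k = 0
      · exact ⟨0, by rw [hk, map_zero, map_zero, map_zero]⟩
      have h1 : mk K₁ (algebraMap K₁ A₁ k) = mk K₁ 1 :=
        mk_eq_mk_iff.2 ⟨k, hk, Algebra.algebraMap_eq_smul_one k⟩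
      have h2 : mk K₂ (F (algebraMap K₁ A₁ k)) = mk K₂ 1 := by
        rw [← hone, ← h1]
        exact (hfρ _).symm
      obtain ⟨a, -, ha⟩ := mk_eq_mk_iff.1 h2
      exact ⟨a, ha.trans (Algebra.algebraMap_eq_smul_one a).symm⟩
    choose α hα using hα
    have inj := (algebraMap K₂ A₂).injective
    refine ⟨⟨⟨⟨α, inj ?_⟩, fun a b => inj ?_⟩, inj ?_, fun a b => inj ?_⟩, hα⟩
    · rw [← hα, map_one, map_one, map_one]
    · rw [map_mul, ← hα, ← hα, ← hα, map_mul, map_mul]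
    · change algebraMap K₂ A₂ (α 0) = _
      rw [← hα, map_zero, map_zero, map_zero]
    · change algebraMap K₂ A₂ (α (a + b)) = algebraMap K₂ A₂ (α a + α b)
      rw [map_add, ← hα, ← hα, ← hα, map_add, map_add]
  · intro g hg
    obtain ⟨a, ha⟩ := hf 1 1
    have h1a := linearIndependent_pair_of_notMem_span (by rw [hf1]; exact one_ne_zero) ha
    obtain ⟨c, hc⟩ := exists_smul_of_forall_exists_smul (g := (g : A₁ →+ A₂)) (h := f)
      (fun x => by
        obtain ⟨c, -, hc⟩ := mk_eq_mk_iff.1 ((hg x).symm.trans (hfρ x))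
        exact ⟨c, hc⟩) h1a
    have hc1 : c • (1 : A₂) = 1 := by
      have e := hc 1
      rw [hf1] at e
      exact e.symm.trans (map_one g)
    ext x
    change g x = f x
    rw [← one_mul (f x), ← hc1, smul_mul_assoc, one_mul]
    exact hc x
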